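/- Conventions. For a topological space $X$ let $\mathbf M$ be the ideal of meager subsets of $X$ and $\wp(X)/\mathbf M$ the Boolean algebra of subsets of $X$ modulo $\mathbf M$; write $[A]$ for the class of $A\subseteq X$. A class is closed if it is of the form $[F]$ with $F\subseteq X$ closed. For every $a\in\wp(X)/\mathbf M$ there is a least closed class above $a$; call it $\mathbf c a$. The pair $\mathbf{Baire}(X)=(\wp(X)/\mathbf M,\mathbf c)$ is a closure algebra, i.e. a Boolean algebra with an operator satisfying $a\le\mathbf c a$, $\mathbf c\mathbf c a\le\mathbf c a$, $\mathbf c(a\vee b)=\mathbf c a\vee\mathbf c b$, $\mathbf c 0=0$. The space $X$ is a Baire space if no nonempty open subset of $X$ is meager. For a cardinal $\kappa\neq0$, a set $Y\subseteq X$ is Baire $\kappa$-resolvable if there is a partition $\{A_\iota\mid\iota<\kappa\}$ of $Y$ into $\kappa$ nonempty, pairwise disjoint sets with $\mathbf c[A_\iota]=[Y]$ for every $\iota$. The space $X$ is nowhere Baire $\kappa$-resolvable if no nonempty open $U\subseteq X$ is Baire $\kappa$-resolvable. Modal formulas over a set of propositional variables are built from the variables by $\wedge,\neg,\Diamond$ (with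 $\to$, $\vee$, $\bot$ defined as usual and $\Box=\neg\Diamond\neg$). $\mathsf{S4}$ is the least set of formulas that contains all classical tautologies, $\Diamond(p\vee q)\to\Diamond p\vee\Diamond q$, $p\to\Diamond p$, $\Diamond\Diamond p\to\Diamond p$ and $\neg\Diamond\bot$, and is closed under uniform substitution, modus ponens, and the rule (Mon): from $\varphi\to\psi$ infer $\Diamond\varphi\to\Diamond\psi$. $\mathsf{S5}$ is obtained by adding the axiom $\Diamond p\to\Box\Diamond p$, and, for $n\ge1$, $\mathsf{S5}_n$ by adding to $\mathsf{S5}$ the axiom $$\bigwedge_{i=1}^{n+1}\Diamond p_i\to\bigvee_{1\le i<j\le n+1}\Diamond(p_i\wedge p_j).$$ $\mathsf{S5}^\lambda$ denotes $\mathsf{S5}$ in the language with $\lambda$ many variables; $\mathsf{S5}_n$ is taken in the language with $\omega$ many variables. A valuation in a closure algebra $B$ assigns elements of $B$ to the variables and is extended to all formulas by interpreting $\wedge,\neg$ by the Boolean operations and $\Diamond$ by $\mathbf c$. A logic $\Lambda$ is sound for $B$ if each $\varphi\in\Lambda$ has value $1$ under every valuation in $B$. Write $\Gamma\models_B\varphi$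 if every valuation in $B$ that gives all members of $\Gamma$ the value $1$ also gives $\varphi$ the value $1$, and $\Gamma\vdash_\Lambda\varphi$ if $\varphi$ is derivable from $\Lambda\cup\Gamma$ by modus ponens and (Mon). $\Lambda$ is strongly complete for $B$ if, for every set $\Gamma$ of formulas and every formula $\varphi$, $\Gamma\models_B\varphi$ implies $\Gamma\vdash_\Lambda\varphi$. Theorem. Let $X$ be a Baire space, let $\lambda$ be a nonzero cardinal, and suppose that $X$ is Baire $\lambda$-resolvable. (1) If $\lambda\ge\omega$, then $\mathsf{S5}^\lambda$ is sound and strongly complete for $\mathbf{Baire}(X)$. (2) If $\lambda=n<\omega$ and $X$ is nowhere Baire $(n+1)$-resolvable, then $\mathsf{S5}_n$ is sound and strongly complete for $\mathbf{Baire}(X)$. -/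

import Mathlib

universe u v

/-! ## Closure algebras -/

/-- A closure algebra: a Boolean algebra with an operator satisfying the Kuratowski axioms. -/
class ClosureAlgebra (B : Type*) extends BooleanAlgebra B where
  /-- the closure operator -/
  cl : B → B
  le_cl : ∀ a, a ≤ cl a
  cl_cl_le : ∀ a, cl (cl a) ≤ cl a
  cl_sup : ∀ a b, cl (a ⊔ b) = cl a ⊔ cl b
  cl_bot : cl ⊥ = ⊥

/-! ## Modal formulas and normal modal logics -/

/-- Formulas of the basic modal language over the set `P` of propositional variables. -/
inductive ModalFormula (P : Type*) : Type _
  | var : P → ModalFormula P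
  | conj : ModalFormula P → ModalFormula P → ModalFormula P
  | neg : ModalFormula P → ModalFormula P
  | dia : ModalFormula P → ModalFormula P

namespace ModalFormula

variable {P : Type*}

/-- Disjunction. -/
def disj (φ ψ : ModalFormula P) : ModalFormula P := neg (conj (neg φ) (neg ψ))

/-- Implication. -/
def imp (φ ψ : ModalFormula P) : ModalFormula P := neg (conj φ (neg ψ))

/-- The box modality. -/
def box (φ : ModalFormula P) : ModalFormula P := neg (dia (neg φ))

/-- The contradiction `φ ∧ ¬ φ`. -/
def contra (φ : ModalFormula P) : ModalFormula P := conj φ (neg φ)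

/-- Uniform substitution of formulas for variables. -/
def subst (σ : P → ModalFormula P) : ModalFormula P → ModalFormula P
  | var p => σ p
  | conj φ ψ => conj (subst σ φ) (subst σ ψ)
  | neg φ => neg (subst σ φ)
  | dia φ => dia (subst σ φ)

/-- The conjunction of a nonempty list of formulas, given as its head and its tail. -/
def listConj : ModalFormula P → List (ModalFormula P) → ModalFormula P
  | φ, [] => φ
  | φ, ψ :: l => conj φ (listConj ψ l)

/-- The disjunction of a list of formulas; the formula `d` is used for the empty list. -/
def listDisj (d : ModalFormula P) : List (ModalFormula P) → ModalFormula P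
  | [] => d
  | [φ] => φ
  | φ :: ψ :: l => disj φ (listDisj d (ψ :: l))

/-- Classical propositional tautologies of the modal language: formulas true under every
two-valued assignment to formulas that respects conjunction and negation (variables and formulas
`◇ φ` being treated as atoms). -/
def IsTautology (φ : ModalFormula P) : Prop :=
  ∀ v : ModalFormula P → Prop,
    (∀ ψ χ, v (conj ψ χ) ↔ (v ψ ∧ v χ)) → (∀ ψ, v (neg ψ) ↔ ¬ v ψ) → v φ

/-- The value of a formula in a closure algebra under an assignment to the variables. -/
def val {B : Type*} [ClosureAlgebra B] (V : P → B) : ModalFormula P → B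
  | var p => V p
  | conj φ ψ => val V φ ⊓ val V ψ
  | neg φ => (val V φ)ᶜ
  | dia φ => ClosureAlgebra.cl (val V φ)

/-- The axiom `5`, `◇ φ → □ ◇ φ`. -/
def axFive (φ : ModalFormula P) : ModalFormula P := imp (dia φ) (box (dia φ))

/-- The formula `(◇ φ₀ ∧ ⋯ ∧ ◇ φₙ) → ⋁ i < j ≤ n, ◇ (φᵢ ∧ φⱼ)` in the `n + 1` formulas
`φ₀, …, φₙ`, for `n ≥ 1`. (For `n = 0` the disjunction is empty, and read as a contradiction.) -/
def axAlt (n : ℕ) (φ : Fin (n + 1) → ModalFormula P) : ModalFormula P :=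
  imp
    (listConj (dia (φ 0)) (List.ofFn fun i : Fin n => dia (φ i.succ)))
    (listDisj (contra (φ 0))
      (((List.finRange (n + 1) ×ˢ List.finRange (n + 1)).filter fun q => q.1 < q.2).map
        fun q => dia (conj (φ q.1) (φ q.2))))

end ModalFormula

open ModalFormula in
/-- The theorems of the least normal extension of `S4` that contains the formulas in `Ax`:
tautologies, the axioms `M`, `T`, `4`, `N` and `Ax`, closed under substitution, modus ponens and
monotonicity of `◇`. -/
inductive S4Extension {P : Type*} (Ax : Set (ModalFormula P)) : ModalFormula P → Prop
  | taut {φ} : IsTautology φ → S4Extension Ax φ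
  | axM (φ ψ) : S4Extension Ax (imp (dia (disj φ ψ)) (disj (dia φ) (dia ψ)))
  | axT (φ) : S4Extension Ax (imp φ (dia φ))
  | axFour (φ) : S4Extension Ax (imp (dia (dia φ)) (dia φ))
  | axN (φ) : S4Extension Ax (neg (dia (contra φ)))
  | extra {φ} : φ ∈ Ax → S4Extension Ax φ
  | sub (σ : P → ModalFormula P) {φ} : S4Extension Ax φ → S4Extension Ax (subst σ φ)
  | mp {φ ψ} : S4Extension Ax φ → S4Extension Ax (imp φ ψ) → S4Extension Ax ψ
  | mon {φ ψ} : S4Extension Ax (imp φ ψ) → S4Extension Ax (imp (dia φ) (dia ψ))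

/-- The logic `S5` over the set `P` of propositional variables, as its set of theorems. -/
def logicS5 (P : Type*) : Set (ModalFormula P) :=
  {φ | S4Extension (Set.range ModalFormula.axFive) φ}

/-- The logic `S5ₙ` over the set `P` of propositional variables, as its set of theorems. -/
def logicS5n (P : Type*) (n : ℕ) : Set (ModalFormula P) :=
  {φ | S4Extension (Set.range ModalFormula.axFive ∪ Set.range (ModalFormula.axAlt n)) φ}

open ModalFormula in
/-- Derivability of a formula from a set `Γ` of hypotheses in a logic `L`: the hypotheses are
treated as axioms, to which modus ponens and monotonicity of `◇` apply. Substitution is applied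
only to theorems of `L` (a logic is already closed under it), not to hypotheses. -/
inductive DerivableFrom {P : Type*} (L Γ : Set (ModalFormula P)) : ModalFormula P → Prop
  | thm {φ} : φ ∈ L → DerivableFrom L Γ φ
  | hyp {φ} : φ ∈ Γ → DerivableFrom L Γ φ
  | mp {φ ψ} : DerivableFrom L Γ φ → DerivableFrom L Γ (imp φ ψ) → DerivableFrom L Γ ψ
  | mon {φ ψ} : DerivableFrom L Γ (imp φ ψ) → DerivableFrom L Γ (imp (dia φ) (dia ψ))

/-- Global consequence over a closure algebra: every valuation under which all members of `Γ`
have value `1` gives `φ` the value `1`. -/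
def GlobalConsequence {P : Type*} (B : Type*) [ClosureAlgebra B] (Γ : Set (ModalFormula P))
    (φ : ModalFormula P) : Prop :=
  ∀ V : P → B, (∀ γ ∈ Γ, ModalFormula.val V γ = ⊤) → ModalFormula.val V φ = ⊤

/-- A logic is sound for a closure algebra if its theorems have value `1` under all valuations. -/
def SoundFor {P : Type*} (L : Set (ModalFormula P)) (B : Type*) [ClosureAlgebra B] : Prop :=
  ∀ φ ∈ L, ∀ V : P → B, ModalFormula.val V φ = ⊤

/-- Strong completeness of a logic for a closure algebra. -/
def StronglyCompleteFor {P : Type*} (L : Set (ModalFormula P)) (B : Type*)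
    [ClosureAlgebra B] : Prop :=
  ∀ (Γ : Set (ModalFormula P)) (φ : ModalFormula P),
    GlobalConsequence B Γ φ → DerivableFrom L Γ φ

/-! ## The Baire algebra of a topological space -/

section BaireAlgebra

variable {X : Type*} [TopologicalSpace X]

/-- The Banach category theorem, relative to a set `A`: if `A` is meagre in each of the open sets
`U ∈ D`, then it is meagre in their union. -/
theorem isMeagre_sUnion_inter (A : Set X) (D : Set (Set X))
    (hD : ∀ U ∈ D, IsOpen U ∧ IsMeagre (U ∩ A)) : IsMeagre (⋃₀ D ∩ A) := by
  obtain ⟨F, hF⟩ := zorn_subset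
    {F : Set (Set X) | (∀ U ∈ F, IsOpen U ∧ IsMeagre (U ∩ A)) ∧ F.PairwiseDisjoint id} (by
      intro c hc hchain
      refine ⟨⋃₀ c, ⟨?_, ?_⟩, fun s hs => Set.subset_sUnion_of_mem hs⟩
      · rintro U ⟨s, hs, hU⟩
        exact (hc hs).1 U hU
      · exact (Set.pairwiseDisjoint_sUnion hchain.directedOn).2 fun s hs => (hc hs).2)
  obtain ⟨hFo, hFd⟩ := hF.prop
  have hVo : IsOpen (⋃₀ F) := isOpen_sUnion fun U hU => (hFo U hU).1
  have hsub : ⋃₀ D ⊆ closure (⋃₀ F) := by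
    rintro x ⟨U, hU, hxU⟩
    by_contra hx
    have hdisj : ∀ W ∈ F, Disjoint (U \ closure (⋃₀ F)) W := fun W hW =>
      Set.disjoint_left.2 fun y hy hyW => hy.2 (subset_closure ⟨W, hW, hyW⟩)
    have hmem : (U \ closure (⋃₀ F)) ∈ F := by
      refine hF.le_of_ge (y := insert (U \ closure (⋃₀ F)) F) ⟨?_, ?_⟩ (Set.subset_insert _ _)
        (Set.mem_insert _ _)
      · rintro W (rfl | hW)
        · exact ⟨(hD U hU).1.sdiff isClosed_closure,
            (hD U hU).2.mono (Set.inter_subset_inter_left _ Set.sdiff_subset)⟩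
        · exact hFo W hW
      · exact hFd.insert fun W hW _ => hdisj W hW
    exact hx (subset_closure ⟨_, hmem, hxU, hx⟩)
  have hN : ∀ U : Set X, ∃ N : ℕ → Set X, U ∈ F →
      (∀ n, IsNowhereDense (N n)) ∧ U ∩ A ⊆ ⋃ n, N n := by
    intro U
    by_cases hU : U ∈ F
    · obtain ⟨S, hS, hSc, hUS⟩ := isMeagre_iff_countable_union_isNowhereDense.1 (hFo U hU).2
      obtain ⟨N, hN⟩ := (hSc.insert ∅).exists_eq_range (Set.insert_nonempty _ _)
      refine ⟨N, fun _ => ⟨fun n => ?_, fun x hx => ?_⟩⟩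
      · have : N n ∈ insert ∅ S := hN ▸ Set.mem_range_self n
        rcases this with h | h
        · rw [h]; exact isNowhereDense_empty
        · exact hS _ h
      · obtain ⟨t, ht, hxt⟩ := hUS hx
        have : t ∈ Set.range N := hN ▸ Set.mem_insert_of_mem _ ht
        obtain ⟨n, rfl⟩ := this
        exact Set.mem_iUnion.2 ⟨n, hxt⟩
    · exact ⟨fun _ => ∅, fun h => absurd h hU⟩
  choose N hN using hN
  have hM : ∀ n, IsNowhereDense (⋃ U ∈ F, N U n ∩ U) := by
    intro n
    rw [IsNowhereDense, Set.eq_empty_iff_forall_notMem]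
    intro x hx
    obtain ⟨y, hyO, hyM⟩ := mem_closure_iff.1 (interior_subset hx) _ isOpen_interior hx
    obtain ⟨U, hU, hyU⟩ := Set.mem_iUnion₂.1 hyM
    have hsubN : interior (closure (⋃ U ∈ F, N U n ∩ U)) ∩ U ⊆ closure (N U n) := by
      rintro z ⟨hz, hzU⟩
      refine mem_closure_iff.2 fun O hO hzO => ?_
      obtain ⟨w, ⟨hwO, hwU⟩, hwM⟩ :=
        mem_closure_iff.1 (interior_subset hz) (O ∩ U) (hO.inter (hFo U hU).1) ⟨hzO, hzU⟩
      obtain ⟨U', hU', hwN, hwU'⟩ := Set.mem_iUnion₂.1 hwM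
      have hUU' : U = U' := hFd.elim_set hU hU' w hwU hwU'
      subst hUU'
      exact ⟨w, hwO, hwN⟩
    have hint := interior_maximal hsubN (isOpen_interior.inter (hFo U hU).1) ⟨hyO, hyU.2⟩
    rw [(hN U hU).1 n] at hint
    exact hint
  have hfr : IsNowhereDense (closure (⋃₀ F) \ ⋃₀ F) := by
    rw [(isClosed_closure.sdiff hVo).isNowhereDense_iff, Set.eq_empty_iff_forall_notMem]
    intro x hx
    obtain ⟨y, hy, hyF⟩ := mem_closure_iff.1 (interior_subset hx).1 _ isOpen_interior hx
    exact (interior_subset hy).2 hyF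
  refine ((isMeagre_iUnion fun n => (hM n).isMeagre).union hfr.isMeagre).mono ?_
  rintro x ⟨hxD, hxA⟩
  by_cases hxF : x ∈ ⋃₀ F
  · left
    obtain ⟨U, hU, hxU⟩ := hxF
    obtain ⟨n, hn⟩ := Set.mem_iUnion.1 ((hN U hU).2 ⟨hxU, hxA⟩)
    exact Set.mem_iUnion.2 ⟨n, Set.mem_iUnion₂.2 ⟨U, hU, hn, hxU⟩⟩
  · exact Or.inr ⟨hsub hxD, hxF⟩

theorem isMeagre_diff_trans {A B C : Set X} (h₁ : IsMeagre (A \ B)) (h₂ : IsMeagre (B \ C)) :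
    IsMeagre (A \ C) :=
  (h₁.union h₂).mono fun x hx => by
    by_cases hB : x ∈ B
    · exact Or.inr ⟨hB, hx.2⟩
    · exact Or.inl ⟨hx.1, hB⟩

theorem isMeagre_diff_of_subset {A B : Set X} (h : A ⊆ B) : IsMeagre (A \ B) := by
  rw [Set.sdiff_eq_empty.2 h]; exact IsMeagre.empty

variable (X) in
/-- Equality of subsets of `X` modulo meagre sets. -/
def meagreSetoid : Setoid (Set X) where
  r A B := IsMeagre (A \ B) ∧ IsMeagre (B \ A)
  iseqv :=
    ⟨fun _ => ⟨isMeagre_diff_of_subset subset_rfl, isMeagre_diff_of_subset subset_rfl⟩,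
      fun h => ⟨h.2, h.1⟩,
      fun h h' => ⟨isMeagre_diff_trans h.1 h'.1, isMeagre_diff_trans h'.2 h.2⟩⟩

variable (X) in
/-- The Baire algebra of `X`: the powerset of `X` modulo the ideal of meagre sets. -/
def BaireAlgebra : Type _ := Quotient (meagreSetoid X)

namespace BaireAlgebra

/-- The class `[A]` of a set `A` modulo meagre sets. -/
def mk (A : Set X) : BaireAlgebra X := Quotient.mk (meagreSetoid X) A

theorem mk_eq_mk {A B : Set X} : mk A = mk B ↔ IsMeagre (A \ B) ∧ IsMeagre (B \ A) :=
  Quotient.eq (r := meagreSetoid X)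

theorem ind {p : BaireAlgebra X → Prop} (h : ∀ A, p (mk A)) (a : BaireAlgebra X) : p a :=
  Quotient.ind h a

/-- The Boolean operations are induced by those of sets, and `[A] ≤ [B]` means that `A \ B` is
meagre. -/
instance instBooleanAlgebra : BooleanAlgebra (BaireAlgebra X) where
  le := Quotient.lift₂ (fun A B => IsMeagre (A \ B)) fun _ _ _ _ h h' => propext
    ⟨fun H => isMeagre_diff_trans h.2 (isMeagre_diff_trans H h'.1),
      fun H => isMeagre_diff_trans h.1 (isMeagre_diff_trans H h'.2)⟩
  sup := Quotient.map₂ (· ∪ ·) fun _ _ h _ _ h' =>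
    ⟨(h.1.union h'.1).mono (by intro x; simp; tauto),
      (h.2.union h'.2).mono (by intro x; simp; tauto)⟩
  inf := Quotient.map₂ (· ∩ ·) fun _ _ h _ _ h' =>
    ⟨(h.1.union h'.1).mono (by intro x; simp; tauto),
      (h.2.union h'.2).mono (by intro x; simp; tauto)⟩
  compl := Quotient.map (fun A => Aᶜ) fun _ _ h =>
    ⟨h.2.mono (by intro x; simp; tauto), h.1.mono (by intro x; simp; tauto)⟩
  top := mk Set.univ
  bot := mk ∅
  le_refl := ind fun _ => isMeagre_diff_of_subset subset_rfl
  le_trans := ind fun _ => ind fun _ => ind fun _ h h' => isMeagre_diff_trans h h'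
  le_antisymm := ind fun _ => ind fun _ h h' => mk_eq_mk.2 ⟨h, h'⟩
  le_sup_left := ind fun _ => ind fun _ => isMeagre_diff_of_subset Set.subset_union_left
  le_sup_right := ind fun _ => ind fun _ => isMeagre_diff_of_subset Set.subset_union_right
  sup_le := ind fun _ => ind fun _ => ind fun _ h h' =>
    (IsMeagre.union h h').mono (by intro x; simp; tauto)
  inf_le_left := ind fun _ => ind fun _ => isMeagre_diff_of_subset Set.inter_subset_left
  inf_le_right := ind fun _ => ind fun _ => isMeagre_diff_of_subset Set.inter_subset_right
  le_inf := ind fun _ => ind fun _ => ind fun _ h h' =>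
    (IsMeagre.union h h').mono (by intro x; simp; tauto)
  le_sup_inf := ind fun _ => ind fun _ => ind fun _ =>
    isMeagre_diff_of_subset (by intro x; simp; tauto)
  le_top := ind fun _ => isMeagre_diff_of_subset (Set.subset_univ _)
  bot_le := ind fun _ => isMeagre_diff_of_subset (Set.empty_subset _)
  inf_compl_le_bot := ind fun _ => isMeagre_diff_of_subset (by intro x; simp)
  top_le_sup_compl := ind fun _ => isMeagre_diff_of_subset (by intro x; simp)

/-- An element of the Baire algebra is closed if it is the class of a closed set. -/
def IsClosedElem (a : BaireAlgebra X) : Prop := ∃ F : Set X, IsClosed F ∧ a = mk F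

/-- Above every element there is a least closed element. -/
theorem exists_isLeast_closed (a : BaireAlgebra X) :
    ∃ b, IsLeast {b | IsClosedElem b ∧ a ≤ b} b := by
  induction a using ind with
  | h A =>
    have hcl : IsClosed (⋂₀ {F : Set X | IsClosed F ∧ IsMeagre (A \ F)}) :=
      isClosed_sInter fun F hF => hF.1
    refine ⟨mk (⋂₀ {F | IsClosed F ∧ IsMeagre (A \ F)}), ⟨⟨_, hcl, rfl⟩, ?_⟩, ?_⟩
    · have := isMeagre_sUnion_inter A (compl '' {F | IsClosed F ∧ IsMeagre (A \ F)}) (by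
        rintro _ ⟨F, hF, rfl⟩
        have hAF : IsMeagre (A \ F) := hF.2
        refine ⟨hF.1.isOpen_compl, hAF.mono ?_⟩
        rintro x ⟨hxF, hxA⟩
        exact ⟨hxA, hxF⟩)
      refine this.mono ?_
      rw [← Set.compl_sInter]
      exact fun x hx => ⟨hx.2, hx.1⟩
    · rintro _ ⟨⟨F, hF, rfl⟩, hAF⟩
      exact isMeagre_diff_of_subset (Set.sInter_subset_of_mem ⟨hF, hAF⟩)

/-- The closure of an element of the Baire algebra: the least closed element above it. -/
noncomputable def closure (a : BaireAlgebra X) : BaireAlgebra X :=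
  (exists_isLeast_closed a).choose

theorem isLeast_closure (a : BaireAlgebra X) :
    IsLeast {b | IsClosedElem b ∧ a ≤ b} (closure a) :=
  (exists_isLeast_closed a).choose_spec

theorem closure_mono {a b : BaireAlgebra X} (h : a ≤ b) : closure a ≤ closure b :=
  (isLeast_closure a).2 ⟨(isLeast_closure b).1.1, h.trans (isLeast_closure b).1.2⟩

noncomputable instance instClosureAlgebra : ClosureAlgebra (BaireAlgebra X) where
  cl := closure
  le_cl a := (isLeast_closure a).1.2
  cl_cl_le a := (isLeast_closure (closure a)).2 ⟨(isLeast_closure a).1.1, le_rfl⟩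
  cl_sup a b := by
    refine le_antisymm ((isLeast_closure (a ⊔ b)).2 ⟨?_, ?_⟩)
      (sup_le (closure_mono le_sup_left) (closure_mono le_sup_right))
    · obtain ⟨F, hF, hFa⟩ := (isLeast_closure a).1.1
      obtain ⟨G, hG, hGb⟩ := (isLeast_closure b).1.1
      exact ⟨F ∪ G, hF.union hG, by rw [hFa, hGb]; rfl⟩
    · exact sup_le_sup (isLeast_closure a).1.2 (isLeast_closure b).1.2
  cl_bot := le_antisymm ((isLeast_closure ⊥).2 ⟨⟨∅, isClosed_empty, rfl⟩, le_rfl⟩) bot_le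

end BaireAlgebra

end BaireAlgebra

/-! ## Baire resolvability -/

/-- A set `Y` is Baire `κ`-resolvable if it can be partitioned into `κ` many sets (nonempty and
pairwise disjoint) whose classes in the Baire algebra of `X` all have closure `[Y]`. -/
def IsBaireResolvable {X : Type*} [TopologicalSpace X] (Y : Set X) (κ : Cardinal) : Prop :=
  ∃ A : κ.out → Set X,
    (∀ i, (A i).Nonempty) ∧ Pairwise (fun i j => Disjoint (A i) (A j)) ∧ (⋃ i, A i) = Y ∧
      ∀ i, ClosureAlgebra.cl (BaireAlgebra.mk (A i)) = BaireAlgebra.mk Y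

/-- A space is somewhere Baire `κ`-resolvable if some nonempty open subset of it is Baire
`κ`-resolvable. -/
def SomewhereBaireResolvable (X : Type*) [TopologicalSpace X] (κ : Cardinal) : Prop :=
  ∃ U : Set X, IsOpen U ∧ U.Nonempty ∧ IsBaireResolvable U κ

/-- A space is nowhere Baire `κ`-resolvable if it is not somewhere Baire `κ`-resolvable. -/
def NowhereBaireResolvable (X : Type*) [TopologicalSpace X] (κ : Cardinal) : Prop :=
  ¬ SomewhereBaireResolvable X κ

/-! Soundness. A closed set differs from its interior by a nowhere dense frontier, so the closed
classes form a Boolean subalgebra and are also the classes of open sets (`IsClosedElem.compl`,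
`IsClosedElem.exists_isOpen`). Hence the complement of a closure is its own closure, which is axiom
5. If `axAlt n` fails, the failing value is a nonzero closed class, say `[U]` with `U` open. On `U`
there are `n + 1` sets, each with closure above `[U]`, that meet pairwise in meagre sets. Meagre
corrections turn them into a resolution of `U` into `n + 1` parts (`isBaireResolvable_of_fin`).

Completeness. The formulas derivable from `Γ` form a theory closed under necessitation. A formula
outside it is refuted by an assignment `u` satisfying it, and the canonical cluster of `u` is an S5
model of `Γ` with the total relation. One witness per formula suffices, so λ worlds are enough when
λ is infinite; under `axAlt n` the cluster has at most `n` elements. Assign the worlds, with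
repetitions, to the parts of a resolution of `X`, and send each variable to the class of the points
whose world satisfies it. Every part has closure `⊤`, so `◇` is evaluated as "in some world"
(`exists_val_eq_top_iff`). -/

/-! ## Propositional theories and assignments -/

namespace ModalFormula

variable {P : Type*}

/-- Two-valued assignments to formulas that respect conjunction and negation. -/
structure IsAssignment (v : ModalFormula P → Prop) : Prop where
  conj_iff : ∀ φ ψ, v (conj φ ψ) ↔ (v φ ∧ v ψ)
  neg_iff : ∀ φ, v (neg φ) ↔ ¬ v φ

theorem IsAssignment.imp_iff {v : ModalFormula P → Prop} (hv : IsAssignment v)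
    (φ ψ : ModalFormula P) : v (imp φ ψ) ↔ (v φ → v ψ) := by
  simp only [imp, hv.conj_iff, hv.neg_iff]; tauto

theorem IsAssignment.disj_iff {v : ModalFormula P → Prop} (hv : IsAssignment v)
    (φ ψ : ModalFormula P) : v (disj φ ψ) ↔ (v φ ∨ v ψ) := by
  simp only [disj, hv.conj_iff, hv.neg_iff]; tauto

theorem IsAssignment.box_iff {v : ModalFormula P → Prop} (hv : IsAssignment v)
    (φ : ModalFormula P) : v (box φ) ↔ ¬ v (dia (neg φ)) :=
  hv.neg_iff _

theorem IsAssignment.not_contra {v : ModalFormula P → Prop} (hv : IsAssignment v)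
    (φ : ModalFormula P) : ¬ v (contra φ) := by
  simp only [contra, hv.conj_iff, hv.neg_iff]; tauto

theorem IsAssignment.listConj_iff {v : ModalFormula P → Prop} (hv : IsAssignment v)
    (φ : ModalFormula P) (l : List (ModalFormula P)) :
    v (listConj φ l) ↔ v φ ∧ ∀ ψ ∈ l, v ψ := by
  induction l generalizing φ with
  | nil => simp [listConj]
  | cons ψ l ih => simp [listConj, hv.conj_iff, ih]

theorem IsAssignment.exists_of_listDisj {v : ModalFormula P → Prop} (hv : IsAssignment v)
    {d : ModalFormula P} (hd : ¬ v d) (l : List (ModalFormula P)) (h : v (listDisj d l)) :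
    ∃ ψ ∈ l, v ψ := by
  induction l with
  | nil => exact absurd h hd
  | cons φ l ih =>
    cases l with
    | nil => exact ⟨φ, by simp, h⟩
    | cons ψ l =>
      rcases (hv.disj_iff _ _).1 h with h | h
      · exact ⟨φ, by simp, h⟩
      · obtain ⟨χ, hχ, hvχ⟩ := ih h
        exact ⟨χ, List.mem_cons_of_mem _ hχ, hvχ⟩

theorem isTautology_iff {φ : ModalFormula P} :
    IsTautology φ ↔ ∀ v : ModalFormula P → Prop, IsAssignment v → v φ :=
  ⟨fun h v hv => h v hv.1 hv.2, fun h v h₁ h₂ => h v ⟨h₁, h₂⟩⟩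

/-- Sets of formulas that contain the tautologies and are closed under modus ponens. -/
structure IsTheory (T : Set (ModalFormula P)) : Prop where
  taut : ∀ φ, (∀ v, IsAssignment v → v φ) → φ ∈ T
  mp : ∀ φ ψ, φ ∈ T → imp φ ψ ∈ T → ψ ∈ T

namespace IsTheory

variable {T : Set (ModalFormula P)}

theorem mem_of_entails (hT : IsTheory T) {φ ψ : ModalFormula P} (hφ : φ ∈ T)
    (h : ∀ v, IsAssignment v → v φ → v ψ) : ψ ∈ T :=
  hT.mp _ _ hφ (hT.taut _ fun v hv => (hv.imp_iff _ _).2 (h v hv))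

theorem mem_of_entails₂ (hT : IsTheory T) {φ ψ χ : ModalFormula P} (hφ : φ ∈ T) (hψ : ψ ∈ T)
    (h : ∀ v, IsAssignment v → v φ → v ψ → v χ) : χ ∈ T :=
  hT.mp _ _ hψ (hT.mem_of_entails hφ fun v hv hvφ => (hv.imp_iff _ _).2 (h v hv hvφ))

/-- The theory obtained by adding a hypothesis. -/
theorem adjoin (hT : IsTheory T) (φ : ModalFormula P) : IsTheory {ψ | imp φ ψ ∈ T} where
  taut ψ hψ := hT.taut _ fun v hv => (hv.imp_iff _ _).2 fun _ => hψ v hv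
  mp ψ χ h₁ h₂ := hT.mem_of_entails₂ h₁ h₂ fun v hv => by simp only [hv.imp_iff]; tauto

/-- Lindenbaum's lemma: a formula outside a theory is refuted by an assignment satisfying the
theory. -/
theorem exists_isAssignment (hT : IsTheory T) {φ : ModalFormula P} (hφ : φ ∉ T) :
    ∃ v, IsAssignment v ∧ (∀ ψ ∈ T, v ψ) ∧ ¬ v φ := by
  obtain ⟨M, hTM, hM⟩ := zorn_subset_nonempty {S : Set (ModalFormula P) | IsTheory S ∧ φ ∉ S} (by
    rintro c hc hchain ⟨S₀, hS₀⟩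
    refine ⟨⋃₀ c, ⟨⟨fun ψ hψ => ⟨S₀, hS₀, (hc hS₀).1.taut ψ hψ⟩, ?_⟩, ?_⟩,
      fun s hs => Set.subset_sUnion_of_mem hs⟩
    · rintro ψ χ ⟨S₁, hS₁, h₁⟩ ⟨S₂, hS₂, h₂⟩
      rcases hchain.total hS₁ hS₂ with h | h
      · exact ⟨S₂, hS₂, (hc hS₂).1.mp _ _ (h h₁) h₂⟩
      · exact ⟨S₁, hS₁, (hc hS₁).1.mp _ _ h₁ (h h₂)⟩
    · rintro ⟨S, hS, h⟩
      exact (hc hS).2 h) T ⟨hT, hφ⟩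
  obtain ⟨hMT, hMφ⟩ := hM.prop
  -- By maximality of `M`, adjoining any new `ψ` yields a theory containing `φ`.
  have himp : ∀ ψ, ψ ∉ M → imp ψ φ ∈ M := by
    intro ψ hψ
    by_contra hn
    have hle : M ⊆ {χ | imp ψ χ ∈ M} := fun χ hχ =>
      hMT.mem_of_entails hχ fun v hv => by simp only [hv.imp_iff]; tauto
    exact hψ (hM.le_of_ge ⟨hMT.adjoin ψ, hn⟩ hle
      (hMT.taut _ fun v hv => (hv.imp_iff _ _).2 id))
  refine ⟨(· ∈ M), ⟨fun ψ χ => ⟨fun h => ⟨?_, ?_⟩, fun h => ?_⟩, fun ψ => ⟨fun h h' => ?_, fun h => ?_⟩⟩,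
    fun ψ hψ => hTM hψ, hMφ⟩
  · exact hMT.mem_of_entails h fun v hv => by simp only [hv.conj_iff]; tauto
  · exact hMT.mem_of_entails h fun v hv => by simp only [hv.conj_iff]; tauto
  · exact hMT.mem_of_entails₂ h.1 h.2 fun v hv => by simp only [hv.conj_iff]; tauto
  · exact hMφ (hMT.mem_of_entails₂ h h' fun v hv => by simp only [hv.neg_iff]; tauto)
  · by_contra hn
    exact hMφ (hMT.mem_of_entails₂ (himp _ h) (himp _ hn) fun v hv => by
      simp only [hv.neg_iff, hv.imp_iff]; tauto)

end IsTheory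

/-! ## Canonical clusters -/

/-- Theories that contain the axioms of `S5` and are closed under monotonicity of `◇`. -/
structure IsS5Theory (D : Set (ModalFormula P)) : Prop extends IsTheory D where
  mon : ∀ φ ψ, imp φ ψ ∈ D → imp (dia φ) (dia ψ) ∈ D
  axM : ∀ φ ψ, imp (dia (disj φ ψ)) (disj (dia φ) (dia ψ)) ∈ D
  axT : ∀ φ, imp φ (dia φ) ∈ D
  axFour : ∀ φ, imp (dia (dia φ)) (dia φ) ∈ D
  axN : ∀ φ, neg (dia (contra φ)) ∈ D
  axFive : ∀ φ, axFive φ ∈ D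

/-- The assignments that satisfy every formula necessary according to `u`. -/
def cluster (u : ModalFormula P → Prop) : Set (ModalFormula P → Prop) :=
  {w | IsAssignment w ∧ ∀ ψ, u (box ψ) → w ψ}

section Cluster

variable {D : Set (ModalFormula P)} {u w : ModalFormula P → Prop}

theorem IsS5Theory.dia_mono (hD : IsS5Theory D) (hu : IsAssignment u) (huD : ∀ ψ ∈ D, u ψ)
    {φ ψ : ModalFormula P} (h : ∀ v, IsAssignment v → v φ → v ψ) (hφ : u (dia φ)) : u (dia ψ) :=
  (hu.imp_iff _ _).1
    (huD _ (hD.mon _ _ (hD.taut _ fun v hv => (hv.imp_iff _ _).2 (h v hv)))) hφ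

theorem IsS5Theory.not_dia_contra (hD : IsS5Theory D) (hu : IsAssignment u)
    (huD : ∀ ψ ∈ D, u ψ) (φ : ModalFormula P) : ¬ u (dia (contra φ)) :=
  (hu.neg_iff _).1 (huD _ (hD.axN φ))

theorem IsS5Theory.dia_or (hD : IsS5Theory D) (hu : IsAssignment u) (huD : ∀ ψ ∈ D, u ψ)
    {φ ψ : ModalFormula P} (h : u (dia (disj φ ψ))) : u (dia φ) ∨ u (dia ψ) :=
  (hu.disj_iff _ _).1 ((hu.imp_iff _ _).1 (huD _ (hD.axM φ ψ)) h)

/-- Necessitation follows from (Mon): `¬φ` implies a contradiction, and no contradiction is possible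
by `axN`. This carries the hypotheses to every member of a cluster. -/
theorem IsS5Theory.box_mem (hD : IsS5Theory D) {φ : ModalFormula P} (hφ : φ ∈ D) :
    box φ ∈ D := by
  have h : imp (neg φ) (contra φ) ∈ D := hD.mem_of_entails hφ fun v hv => by
    simp only [hv.imp_iff, hv.neg_iff]; tauto
  exact hD.mem_of_entails₂ (hD.mon _ _ h) (hD.axN φ) fun v hv => by
    simp only [hv.imp_iff, hv.neg_iff, box]; tauto

theorem IsS5Theory.of_mem_cluster (hD : IsS5Theory D) (huD : ∀ ψ ∈ D, u ψ)
    (hw : w ∈ cluster u) : ∀ ψ ∈ D, w ψ :=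
  fun ψ hψ => hw.2 ψ (huD _ (hD.box_mem hψ))

theorem IsS5Theory.self_mem_cluster (hD : IsS5Theory D) (hu : IsAssignment u)
    (huD : ∀ ψ ∈ D, u ψ) : u ∈ cluster u := by
  refine ⟨hu, fun ψ h => ?_⟩
  by_contra hψ
  exact (hu.box_iff _).1 h ((hu.imp_iff _ _).1 (huD _ (hD.axT _)) ((hu.neg_iff _).2 hψ))

/-- Axiom 5 makes a true `◇ψ` necessary, and axiom 4 makes a false one necessarily false. So the
cluster needs no accessibility relation. -/
theorem IsS5Theory.dia_iff_of_mem_cluster (hD : IsS5Theory D) (hu : IsAssignment u)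
    (huD : ∀ ψ ∈ D, u ψ) (hw : w ∈ cluster u) (ψ : ModalFormula P) :
    w (dia ψ) ↔ u (dia ψ) := by
  refine ⟨fun h => ?_, fun h => hw.2 _ ((hu.imp_iff _ _).1 (huD _ (hD.axFive ψ)) h)⟩
  by_contra hn
  refine (hw.1.neg_iff _).1 (hw.2 (neg (dia ψ)) ((hu.box_iff _).2 fun h' => hn ?_)) h
  exact (hu.imp_iff _ _).1 (huD _ (hD.axFour ψ))
    (hD.dia_mono hu huD (fun v hv => by simp only [hv.neg_iff]; tauto) h')

/-- The formulas strictly implied by `ψ` at `u` form a theory, consistent because `u` satisfies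
`◇ψ`. An assignment satisfying it is the required witness. -/
theorem IsS5Theory.exists_mem_cluster (hD : IsS5Theory D) (hu : IsAssignment u)
    (huD : ∀ ψ ∈ D, u ψ) {ψ : ModalFormula P} (h : u (dia ψ)) : ∃ w ∈ cluster u, w ψ := by
  have hT : IsTheory {χ | u (box (imp ψ χ))} :=
    { taut := fun χ hχ => (hu.box_iff _).2 fun h' => hD.not_dia_contra hu huD ψ
        (hD.dia_mono hu huD (fun v hv hv' => by
          have := hχ v hv
          simp only [hv.neg_iff, hv.imp_iff] at hv'; tauto) h')
      mp := fun χ θ h₁ h₂ => (hu.box_iff _).2 fun h' => by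
        rcases hD.dia_or hu huD (φ := neg (imp ψ χ)) (ψ := neg (imp ψ (imp χ θ)))
          (hD.dia_mono hu huD (fun v hv hv' => by
            simp only [hv.neg_iff, hv.imp_iff, hv.disj_iff] at hv' ⊢; tauto) h') with h'' | h''
        · exact (hu.box_iff _).1 h₁ h''
        · exact (hu.box_iff _).1 h₂ h'' }
  obtain ⟨w, hw, hwT, -⟩ := hT.exists_isAssignment (φ := contra ψ) fun h' =>
    (hu.box_iff _).1 h' (hD.dia_mono hu huD (fun v hv hvψ => by
      have := hv.not_contra ψ
      simp only [hv.neg_iff, hv.imp_iff]; tauto) h)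
  refine ⟨w, ⟨hw, fun χ hχ => hwT χ ((hu.box_iff _).2 fun h' => (hu.box_iff _).1 hχ ?_)⟩,
    hwT ψ ((hu.box_iff _).2 fun h' => hD.not_dia_contra hu huD ψ ?_)⟩
  · exact hD.dia_mono hu huD (fun v hv => by simp only [hv.neg_iff, hv.imp_iff]; tauto) h'
  · exact hD.dia_mono hu huD (fun v hv => by simp only [hv.neg_iff, hv.imp_iff]; tauto) h'

/-- The truth lemma for canonical clusters. -/
theorem IsS5Theory.dia_iff_exists (hD : IsS5Theory D) (hu : IsAssignment u)
    (huD : ∀ ψ ∈ D, u ψ) (ψ : ModalFormula P) : u (dia ψ) ↔ ∃ w ∈ cluster u, w ψ := by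
  refine ⟨hD.exists_mem_cluster hu huD, ?_⟩
  rintro ⟨w, hw, hwψ⟩
  exact (hD.dia_iff_of_mem_cluster hu huD hw ψ).1
    ((hw.1.imp_iff _ _).1 (hD.of_mem_cluster huD hw _ (hD.axT ψ)) hwψ)

end Cluster

/-! ### Universal models -/

/-- A family of assignments is a universal model if `◇` is interpreted by existential
quantification over the family. -/
structure IsUniversalModel {ι : Type*} (F : ι → ModalFormula P → Prop) : Prop where
  isAssignment : ∀ i, IsAssignment (F i)
  dia_iff : ∀ i ψ, F i (dia ψ) ↔ ∃ j, F j ψ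

/-- A formula outside an `S5` theory is refuted in a universal model of the theory whose worlds are
indexed by the formulas. -/
theorem IsS5Theory.exists_isUniversalModel {D : Set (ModalFormula P)} (hD : IsS5Theory D)
    {φ : ModalFormula P} (hφ : φ ∉ D) : ∃ F : ModalFormula P → ModalFormula P → Prop,
      IsUniversalModel F ∧ (∀ i, ∀ ψ ∈ D, F i ψ) ∧ ∃ i, ¬ F i φ := by
  obtain ⟨u, hu, huD, huφ⟩ := hD.exists_isAssignment hφ
  have huu := hD.self_mem_cluster hu huD
  -- The whole cluster may be too large; one witness for each possible formula is kept, with `u` as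
  -- default.
  have : ∀ ψ, ∃ w ∈ cluster u, u (dia ψ) → w ψ := by
    intro ψ
    by_cases h : u (dia ψ)
    · obtain ⟨w, hw, hwψ⟩ := hD.exists_mem_cluster hu huD h
      exact ⟨w, hw, fun _ => hwψ⟩
    · exact ⟨u, huu, fun h' => absurd h' h⟩
  choose F hF hFd using this
  refine ⟨F, ⟨fun i => (hF i).1, fun i ψ => ?_⟩, fun i => hD.of_mem_cluster huD (hF i),
    neg φ, ?_⟩
  · rw [hD.dia_iff_of_mem_cluster hu huD (hF i)]
    exact ⟨fun h => ⟨ψ, hFd ψ h⟩,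
      fun ⟨j, hj⟩ => (hD.dia_iff_exists hu huD ψ).2 ⟨F j, hF j, hj⟩⟩
  -- `u` refutes `φ`, so `◇¬φ` holds at `u` and the witness indexed by `neg φ` also refutes `φ`.
  · exact ((hF _).1.neg_iff _).1
      (hFd _ ((hD.dia_iff_exists hu huD _).2 ⟨u, huu, (hu.neg_iff _).2 huφ⟩))

/-- If all instances of `axAlt n` hold, canonical clusters have at most `n` elements. -/
theorem IsS5Theory.not_injective_cluster {D : Set (ModalFormula P)} (hD : IsS5Theory D)
    {n : ℕ} (hAlt : ∀ φ, axAlt n φ ∈ D) {u : ModalFormula P → Prop} (hu : IsAssignment u)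
    (huD : ∀ ψ ∈ D, u ψ) (φ : ModalFormula P) (f : Fin (n + 1) → cluster u) :
    ¬ Function.Injective f := by
  intro hf
  -- For `j = i` any formula true at `f i` will do; `φ` or its negation is taken.
  have hsep : ∀ i j, ∃ δ, (f i).1 δ ∧ (j ≠ i → ¬ (f j).1 δ) := by
    intro i j
    have hi := (f i).2.1
    have hj := (f j).2.1
    by_cases hij : j = i
    · by_cases h : (f i).1 φ
      · exact ⟨φ, h, fun h' => absurd hij h'⟩
      · exact ⟨neg φ, (hi.neg_iff _).2 h, fun h' => absurd hij h'⟩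
    · have hne : (f i).1 ≠ (f j).1 := fun h => hij (hf (Subtype.ext h)).symm
      obtain ⟨δ, hδ⟩ := Function.ne_iff.1 hne
      by_cases h : (f i).1 δ
      · exact ⟨δ, h, fun _ h' => hδ (by simp [h, h'])⟩
      · refine ⟨neg δ, (hi.neg_iff _).2 h, fun _ h' => hδ ?_⟩
        simp [h, (hj.neg_iff _).1 h']
  choose δ hδ hδ' using hsep
  have hα : ∀ i, ∃ α, (f i).1 α ∧ ∀ j, j ≠ i → ¬ (f j).1 α := fun i =>
    -- The head of the conjunction is a tautology, serving as its neutral element.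
    ⟨listConj φ.neg.contra.neg (List.ofFn (δ i)), by
      rw [(f i).2.1.listConj_iff]
      refine ⟨((f i).2.1.neg_iff _).2 ((f i).2.1.not_contra _), fun ψ hψ => ?_⟩
      obtain ⟨j, rfl⟩ := List.mem_ofFn.1 hψ
      exact hδ i j, fun j hj h =>
        hδ' i j hj (((f j).2.1.listConj_iff _ _).1 h |>.2 _ (List.mem_ofFn.2 ⟨j, rfl⟩))⟩
  choose α hα hα' using hα
  -- The `α i` separate only the chosen worlds. The `χ i` are incompatible under every assignment,
  -- hence also at a witness of `◇(χ i ∧ χ j)` elsewhere in the cluster.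
  let χ : Fin (n + 1) → ModalFormula P := fun i =>
    listConj (α i) (((List.finRange (n + 1)).filter (· ≠ i)).map fun j => neg (α j))
  have hχ : ∀ i, (f i).1 (χ i) := by
    intro i
    refine ((f i).2.1.listConj_iff _ _).2 ⟨hα i, fun ψ hψ => ?_⟩
    simp only [List.mem_map, List.mem_filter, List.mem_finRange, true_and,
      decide_eq_true_eq] at hψ
    obtain ⟨j, hj, rfl⟩ := hψ
    exact ((f i).2.1.neg_iff _).2 (hα' j i (Ne.symm hj))
  have hdisj : ∀ w, IsAssignment w → ∀ i j, i ≠ j → ¬ (w (χ i) ∧ w (χ j)) := by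
    intro w hw i j hij h
    refine (hw.neg_iff _).1 (((hw.listConj_iff _ _).1 h.1).2 (neg (α j)) ?_)
      ((hw.listConj_iff _ _).1 h.2).1
    simp only [List.mem_map, List.mem_filter, List.mem_finRange, true_and, decide_eq_true_eq]
    exact ⟨j, hij.symm, rfl⟩
  have hdia : ∀ i, u (dia (χ i)) := fun i =>
    (hD.dia_iff_exists hu huD _).2 ⟨(f i).1, (f i).2, hχ i⟩
  have hax := (hu.imp_iff _ _).1 (huD _ (hAlt χ)) ((hu.listConj_iff _ _).2 ⟨hdia 0, by
    intro ψ hψ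
    obtain ⟨j, rfl⟩ := List.mem_ofFn.1 hψ
    exact hdia _⟩)
  obtain ⟨ψ, hψ, huψ⟩ := hu.exists_of_listDisj (hu.not_contra _) _ hax
  simp only [List.mem_map, List.mem_filter, decide_eq_true_eq] at hψ
  obtain ⟨⟨i, j⟩, ⟨-, hij⟩, rfl⟩ := hψ
  obtain ⟨w, hw, hwψ⟩ := (hD.dia_iff_exists hu huD _).1 huψ
  exact hdisj w hw.1 i j hij.ne ((hw.1.conj_iff _ _).1 hwψ)

theorem _root_.exists_surjective_fin_of_not_injective {α : Type*} [Nonempty α] {n : ℕ}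
    (h : ∀ f : Fin (n + 1) → α, ¬ Function.Injective f) :
    ∃ g : Fin n → α, Function.Surjective g := by
  have : Finite α := by
    by_contra hα
    rw [not_finite_iff_infinite] at hα
    exact h (fun i => Infinite.natEmbedding α i)
      ((Infinite.natEmbedding α).injective.comp Fin.val_injective)
  have := Fintype.ofFinite α
  have hcard : Fintype.card α ≤ Fintype.card (Fin n) := by
    rw [Fintype.card_fin]
    by_contra hn
    obtain ⟨e⟩ := Function.Embedding.nonempty_of_card_le (α := Fin (n + 1)) (β := α)
      (by rw [Fintype.card_fin]; omega)
    exact h e e.injective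
  obtain ⟨e⟩ := Function.Embedding.nonempty_of_card_le hcard
  exact ⟨Function.invFun e, Function.invFun_surjective e.injective⟩

/-- In the presence of `axAlt n`, a formula outside an `S5` theory is refuted in a universal model
of the theory with worlds indexed by `Fin n`. -/
theorem IsS5Theory.exists_isUniversalModel_fin {D : Set (ModalFormula P)} (hD : IsS5Theory D)
    {n : ℕ} (hAlt : ∀ φ, axAlt n φ ∈ D) {φ : ModalFormula P} (hφ : φ ∉ D) :
    ∃ F : Fin n → ModalFormula P → Prop,
      IsUniversalModel F ∧ (∀ i, ∀ ψ ∈ D, F i ψ) ∧ ∃ i, ¬ F i φ := by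
  obtain ⟨u, hu, huD, huφ⟩ := hD.exists_isAssignment hφ
  have huu := hD.self_mem_cluster hu huD
  have : Nonempty (cluster u) := ⟨⟨u, huu⟩⟩
  obtain ⟨g, hg⟩ := exists_surjective_fin_of_not_injective
    (hD.not_injective_cluster hAlt hu huD φ)
  refine ⟨fun i => (g i).1, ⟨fun i => (g i).2.1, fun i ψ => ?_⟩,
    fun i => hD.of_mem_cluster huD (g i).2, ?_⟩
  · rw [hD.dia_iff_of_mem_cluster hu huD (g i).2, hD.dia_iff_exists hu huD]
    constructor
    · rintro ⟨w, hw, hwψ⟩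
      obtain ⟨j, hj⟩ := hg ⟨w, hw⟩
      exact ⟨j, by rw [hj]; exact hwψ⟩
    · rintro ⟨j, hj⟩
      exact ⟨_, (g j).2, hj⟩
  · obtain ⟨i, hi⟩ := hg ⟨u, huu⟩
    exact ⟨i, by simpa only [hi] using huφ⟩

/-- Repeating worlds is harmless, so a model can be spread over any larger index set, such as the
parts of a resolution. -/
theorem IsUniversalModel.comp {ι κ : Type*} {F : ι → ModalFormula P → Prop}
    (hF : IsUniversalModel F) {g : κ → ι} (hg : Function.Surjective g) :
    IsUniversalModel (F ∘ g) where
  isAssignment i := hF.isAssignment (g i)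
  dia_iff i ψ := by simp only [Function.comp_apply, hF.dia_iff, hg.exists]

/-! ## The number of formulas -/

/-- Evaluation of a formula in Polish notation, applied to a stack of formulas. -/
def evalPolish : List (P ⊕ Fin 3) → List (ModalFormula P)
  | [] => []
  | Sum.inl p :: l => var p :: evalPolish l
  | Sum.inr k :: l =>
    match k, evalPolish l with
    | 0, φ :: ψ :: s => conj φ ψ :: s
    | 1, φ :: s => neg φ :: s
    | 2, φ :: s => dia φ :: s
    -- Ill-formed words get a junk value; only codes of formulas matter.
    | _, s => s

theorem exists_evalPolish (φ : ModalFormula P) :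
    ∃ l : List (P ⊕ Fin 3), ∀ r, evalPolish (l ++ r) = φ :: evalPolish r := by
  induction φ with
  | var p => exact ⟨[Sum.inl p], fun r => by simp [evalPolish]⟩
  | conj φ ψ ihφ ihψ =>
    obtain ⟨l, hl⟩ := ihφ
    obtain ⟨m, hm⟩ := ihψ
    exact ⟨Sum.inr 0 :: (l ++ m), fun r => by simp [evalPolish, hl, hm]⟩
  | neg φ ih =>
    obtain ⟨l, hl⟩ := ih
    exact ⟨Sum.inr 1 :: l, fun r => by simp [evalPolish, hl]⟩
  | dia φ ih =>
    obtain ⟨l, hl⟩ := ih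
    exact ⟨Sum.inr 2 :: l, fun r => by simp [evalPolish, hl]⟩

/-- Polish notation encodes formulas injectively as words over `P ⊕ Fin 3`, and an infinite alphabet
has as many words as letters. -/
theorem mk_le_mk_of_infinite (P : Type*) [Infinite P] :
    Cardinal.mk (ModalFormula P) ≤ Cardinal.mk P := by
  have hinj : Function.Injective fun φ : ModalFormula P => (exists_evalPolish φ).choose := by
    intro φ ψ h
    have hφ := (exists_evalPolish φ).choose_spec []
    have hψ := (exists_evalPolish ψ).choose_spec []
    simp only at h
    rw [h, hψ] at hφ
    exact (List.cons.inj hφ).1.symm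
  refine (Cardinal.mk_le_of_injective hinj).trans ?_
  rw [Cardinal.mk_list_eq_mk, Cardinal.mk_sum]
  simp only [Cardinal.lift_uzero, Cardinal.mk_fin, Cardinal.lift_natCast]
  have h := Cardinal.aleph0_le_mk P
  exact (Cardinal.add_nat_eq 3 h).le

/-! ## Soundness -/

section Soundness

variable {B : Type*} [ClosureAlgebra B]

theorem val_imp_eq_top_iff (V : P → B) (φ ψ : ModalFormula P) :
    val V (imp φ ψ) = ⊤ ↔ val V φ ≤ val V ψ := by
  simp only [imp, val]
  rw [compl_eq_top, ← disjoint_iff, disjoint_compl_right_iff]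

theorem val_disj (V : P → B) (φ ψ : ModalFormula P) :
    val V (disj φ ψ) = val V φ ⊔ val V ψ := by
  simp [disj, val, compl_inf]

theorem val_contra (V : P → B) (φ : ModalFormula P) : val V (contra φ) = ⊥ := by
  simp [contra, val]

theorem val_subst (σ : P → ModalFormula P) (V : P → B) (φ : ModalFormula P) :
    val V (subst σ φ) = val (fun p => val V (σ p)) φ := by
  induction φ with
  | var p => rfl
  | conj φ ψ ih₁ ih₂ => simp [subst, val, ih₁, ih₂]
  | neg φ ih => simp [subst, val, ih]
  | dia φ ih => simp [subst, val, ih]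

theorem val_listConj (V : P → B) (φ : ModalFormula P) (l : List (ModalFormula P)) :
    val V (listConj φ l) ≤ val V φ ∧ ∀ ψ ∈ l, val V (listConj φ l) ≤ val V ψ := by
  induction l generalizing φ with
  | nil => simp [listConj]
  | cons ψ l ih =>
    have h := ih ψ
    simp only [listConj, val, inf_le_left, List.mem_cons, forall_eq_or_imp, true_and]
    exact ⟨inf_le_right.trans h.1, fun χ hχ => inf_le_right.trans (h.2 χ hχ)⟩

theorem val_le_val_listDisj (V : P → B) (d : ModalFormula P) (l : List (ModalFormula P)) :
    ∀ ψ ∈ l, val V ψ ≤ val V (listDisj d l) := by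
  induction l with
  | nil => simp
  | cons φ l ih =>
    cases l with
    | nil => simp [listDisj]
    | cons ψ l =>
      intro χ hχ
      rw [listDisj, val_disj]
      rcases List.mem_cons.1 hχ with rfl | hχ
      · exact le_sup_left
      · exact (ih χ hχ).trans le_sup_right

/-- If the value is not `⊤`, it lies in a prime ideal; "the value is outside the ideal" is then an
assignment that refutes the formula. -/
theorem val_eq_top_of_isTautology {φ : ModalFormula P} (h : IsTautology φ) (V : P → B) :
    val V φ = ⊤ := by
  by_contra hne
  obtain ⟨J, hJ, hφJ, -⟩ := DistribLattice.prime_ideal_of_disjoint_filter_ideal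
    (F := Order.PFilter.principal (⊤ : B)) (I := Order.Ideal.principal (val V φ)) (by
      rw [Set.disjoint_left]
      intro x hx hx'
      have h₁ : ⊤ ≤ x := hx
      have h₂ : x ≤ val V φ := hx'
      exact hne (top_le_iff.1 (h₁.trans h₂)))
  refine h (fun ψ => val V ψ ∉ J) (fun ψ χ => ?_) (fun ψ => ?_) (hφJ (le_refl (val V φ)))
  · rw [← not_or, not_iff_not]
    exact ⟨hJ.mem_or_mem, fun h => h.elim (J.lower inf_le_left) (J.lower inf_le_right)⟩
  · rw [not_iff_not]
    refine ⟨fun h₁ h₂ => ?_, fun h' => (hJ.mem_or_compl_mem (x := val V ψ)).resolve_left h'⟩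
    refine hJ.toIsProper.top_notMem ?_
    rw [← sup_compl_eq_top (x := val V ψ)]
    exact Order.Ideal.sup_mem h₂ h₁

theorem cl_mono {a b : B} (h : a ≤ b) : ClosureAlgebra.cl a ≤ ClosureAlgebra.cl b := by
  rw [← sup_eq_right.2 h, ClosureAlgebra.cl_sup]
  exact le_sup_left

/-- Extensions of `S4` by valid axioms are sound. -/
theorem _root_.S4Extension.val_eq_top {Ax : Set (ModalFormula P)}
    (hAx : ∀ φ ∈ Ax, ∀ V : P → B, val V φ = ⊤) {φ : ModalFormula P} (h : S4Extension Ax φ) :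
    ∀ V : P → B, val V φ = ⊤ := by
  induction h with
  | taut h => exact val_eq_top_of_isTautology h
  | axM φ ψ =>
    intro V
    simp [val_imp_eq_top_iff, val_disj, val, ClosureAlgebra.cl_sup]
  | axT =>
    intro V
    rw [val_imp_eq_top_iff]
    exact ClosureAlgebra.le_cl _
  | axFour =>
    intro V
    rw [val_imp_eq_top_iff]
    exact ClosureAlgebra.cl_cl_le _
  | axN φ =>
    intro V
    rw [val, val, val_contra, ClosureAlgebra.cl_bot, compl_bot]
  | extra h => exact hAx _ h
  | sub σ _ ih =>
    intro V
    rw [val_subst]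
    exact ih _
  | mp _ _ ih₁ ih₂ =>
    intro V
    have := (val_imp_eq_top_iff V _ _).1 (ih₂ V)
    rwa [ih₁ V, top_le_iff] at this
  | mon _ ih =>
    intro V
    exact (val_imp_eq_top_iff V _ _).2 (cl_mono ((val_imp_eq_top_iff V _ _).1 (ih V)))

end Soundness

/-- Derivable formulas form an `S5` theory. -/
theorem isS5Theory_derivableFrom {Ax : Set (ModalFormula P)}
    (hAx : Set.range ModalFormula.axFive ⊆ Ax) (Γ : Set (ModalFormula P)) :
    IsS5Theory {φ | DerivableFrom {ψ | S4Extension Ax ψ} Γ φ} where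
  taut φ h := .thm (.taut (isTautology_iff.2 h))
  mp _ _ := .mp
  mon _ _ := .mon
  axM φ ψ := .thm (.axM φ ψ)
  axT φ := .thm (.axT φ)
  axFour φ := .thm (.axFour φ)
  axN φ := .thm (.axN φ)
  axFive φ := .thm (.extra (hAx ⟨φ, rfl⟩))

end ModalFormula

/-! ## The Baire algebra -/

namespace BaireAlgebra

variable {X : Type*} [TopologicalSpace X]

/-- A closed set equals its interior modulo its frontier, which is nowhere dense. -/
theorem IsClosedElem.compl {a : BaireAlgebra X} (ha : IsClosedElem a) : IsClosedElem aᶜ := by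
  obtain ⟨F, hF, rfl⟩ := ha
  refine ⟨(interior F)ᶜ, isOpen_interior.isClosed_compl, mk_eq_mk.2 ⟨?_, ?_⟩⟩
  · exact isMeagre_diff_of_subset (Set.compl_subset_compl.2 interior_subset)
  · have : IsNowhereDense (frontier F) := by
      rw [isClosed_frontier.isNowhereDense_iff]
      exact interior_frontier hF
    refine this.isMeagre.mono ?_
    rw [hF.frontier_eq]
    rintro x ⟨h₁, h₂⟩
    exact ⟨not_not.1 h₂, h₁⟩

theorem IsClosedElem.inf {a b : BaireAlgebra X} (ha : IsClosedElem a) (hb : IsClosedElem b) :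
    IsClosedElem (a ⊓ b) := by
  obtain ⟨F, hF, rfl⟩ := ha
  obtain ⟨G, hG, rfl⟩ := hb
  exact ⟨F ∩ G, hF.inter hG, rfl⟩

theorem isClosedElem_bot : IsClosedElem (⊥ : BaireAlgebra X) := ⟨∅, isClosed_empty, rfl⟩

theorem isClosedElem_cl (a : BaireAlgebra X) : IsClosedElem (ClosureAlgebra.cl a) :=
  (isLeast_closure a).1.1

theorem cl_le_iff {a b : BaireAlgebra X} (hb : IsClosedElem b) : ClosureAlgebra.cl a ≤ b ↔ a ≤ b :=
  ⟨(isLeast_closure a).1.2.trans, fun h => (isLeast_closure a).2 ⟨hb, h⟩⟩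

/-- Closed elements are also open: they are classes of open sets. -/
theorem IsClosedElem.exists_isOpen {a : BaireAlgebra X} (ha : IsClosedElem a) :
    ∃ U : Set X, IsOpen U ∧ a = mk U := by
  obtain ⟨F, hF, h⟩ := ha.compl
  exact ⟨Fᶜ, hF.isOpen_compl, by rw [← compl_compl a, h]; rfl⟩

/-- By residuation, the nontrivial inequality asks that `cl a` lie below `b ⇨ cl (a ⊓ b)`. That
element is closed, because complements of closed elements are, so it is enough that it lies above
`a`. -/
theorem cl_inf_of_isClosedElem (a : BaireAlgebra X) {b : BaireAlgebra X} (hb : IsClosedElem b) :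
    ClosureAlgebra.cl (a ⊓ b) = ClosureAlgebra.cl a ⊓ b := by
  refine le_antisymm ?_ ?_
  · exact (cl_le_iff ((isClosedElem_cl a).inf hb)).2
      (inf_le_inf_right b (ClosureAlgebra.le_cl a))
  · rw [← le_himp_iff, himp_eq, cl_le_iff]
    · rw [← himp_eq, le_himp_iff]
      exact ClosureAlgebra.le_cl _
    · rw [← compl_compl (_ ⊔ _), compl_sup]
      exact ((isClosedElem_cl _).compl.inf hb.compl.compl).compl

theorem mk_eq_bot_iff {A : Set X} : mk A = ⊥ ↔ IsMeagre A := by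
  change mk A = mk ∅ ↔ _
  rw [mk_eq_mk]
  simp [IsMeagre.empty]

theorem mk_ne_bot_of_isOpen [BaireSpace X] {U : Set X} (hU : IsOpen U) (hne : U.Nonempty) :
    mk U ≠ ⊥ := by
  rw [Ne, mk_eq_bot_iff]
  exact not_isMeagre_of_isOpen hU hne

/-! ### Validity of the axioms in the Baire algebra -/

theorem val_axFive {P : Type*} (V : P → BaireAlgebra X) (φ : ModalFormula P) :
    ModalFormula.val V (ModalFormula.axFive φ) = ⊤ := by
  rw [ModalFormula.axFive, ModalFormula.val_imp_eq_top_iff]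
  simp only [ModalFormula.box, ModalFormula.val]
  rw [le_compl_comm, cl_le_iff (isClosedElem_cl _).compl]

theorem isClosedElem_val_listConj {P : Type*} (V : P → BaireAlgebra X) (φ : ModalFormula P)
    (l : List (ModalFormula P)) (hφ : IsClosedElem (ModalFormula.val V φ))
    (hl : ∀ ψ ∈ l, IsClosedElem (ModalFormula.val V ψ)) :
    IsClosedElem (ModalFormula.val V (ModalFormula.listConj φ l)) := by
  induction l generalizing φ with
  | nil => exact hφ
  | cons ψ l ih =>
    exact hφ.inf (ih ψ (hl ψ (by simp)) fun χ hχ => hl χ (List.mem_cons_of_mem _ hχ))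

theorem isClosedElem_val_listDisj {P : Type*} (V : P → BaireAlgebra X) (d : ModalFormula P)
    (l : List (ModalFormula P)) (hd : IsClosedElem (ModalFormula.val V d))
    (hl : ∀ ψ ∈ l, IsClosedElem (ModalFormula.val V ψ)) :
    IsClosedElem (ModalFormula.val V (ModalFormula.listDisj d l)) := by
  induction l with
  | nil => exact hd
  | cons φ l ih =>
    cases l with
    | nil => exact hl φ (by simp)
    | cons ψ l =>
      exact ((hl φ (by simp)).compl.inf
        (ih fun χ hχ => hl χ (List.mem_cons_of_mem _ hχ)).compl).compl

/-- A nonempty open set is resolvable if it carries finitely many sets that are dense in it modulo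
meagre sets and pairwise disjoint modulo meagre sets. -/
theorem isBaireResolvable_of_fin [BaireSpace X] {n : ℕ} {U : Set X} (hU : IsOpen U)
    (hne : U.Nonempty) (A : Fin (n + 1) → Set X)
    (hA : ∀ i, mk U ≤ ClosureAlgebra.cl (mk (A i)))
    (hdisj : ∀ i j, i < j → Disjoint (mk U) (mk (A i ∩ A j))) {κ : Cardinal}
    (hκ : κ = ((n + 1 : ℕ) : Cardinal)) : IsBaireResolvable U κ := by
  have hUc : IsClosedElem (mk U) := by
    rw [← compl_compl (mk U)]
    exact IsClosedElem.compl ⟨Uᶜ, hU.isClosed_compl, rfl⟩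
  have hUbot := mk_ne_bot_of_isOpen hU hne
  -- Removing the earlier `A j` makes the sets disjoint at the cost of a meagre set within `U`; the
  -- leftover points of `U` are then put into part `0`.
  let C : Fin (n + 1) → Set X := fun i => (U ∩ A i) \ ⋃ j < i, A j
  let E : Fin (n + 1) → Set X := fun i => if i = 0 then C 0 ∪ (U \ ⋃ j, C j) else C i
  have hCE : ∀ i, C i ⊆ E i := by
    intro i
    by_cases h : i = 0
    · subst h; simp [E]
    · simp [E, h]
  have hEC : ∀ i x, x ∈ E i → x ∈ C i ∨ i = 0 ∧ x ∈ U \ ⋃ j, C j := by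
    intro i x hx
    by_cases h : i = 0
    · subst h
      simp only [E, if_true] at hx
      exact hx.imp_right fun h => ⟨rfl, h⟩
    · simp only [E, h, if_false] at hx
      exact Or.inl hx
  have hCU : ∀ i, C i ⊆ U := fun i x hx => hx.1.1
  have hEU : ∀ i, E i ⊆ U := fun i x hx => (hEC i x hx).elim (fun h => hCU i h) fun h => h.2.1
  have hmkC : ∀ i, mk (U ∩ A i) ≤ mk (C i) := by
    intro i
    change IsMeagre ((U ∩ A i) \ C i)
    have : ∀ j, IsMeagre (if j < i then U ∩ (A j ∩ A i) else ∅) := by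
      intro j
      split_ifs with h
      · exact mk_eq_bot_iff.1 (disjoint_iff.1 (hdisj j i h))
      · exact IsMeagre.empty
    refine (isMeagre_iUnion this).mono ?_
    rintro x ⟨hx, hxC⟩
    have hx' : x ∈ ⋃ j < i, A j := by
      by_contra h
      exact hxC ⟨hx, h⟩
    simp only [Set.mem_iUnion] at hx' ⊢
    obtain ⟨j, hj, hxj⟩ := hx'
    exact ⟨j, by rw [if_pos hj]; exact ⟨hx.1, hxj, hx.2⟩⟩
  have hclE : ∀ i, ClosureAlgebra.cl (mk (E i)) = mk U := by
    intro i
    refine le_antisymm ((cl_le_iff hUc).2 (isMeagre_diff_of_subset (hEU i))) ?_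
    -- Closure commutes with the meet by the closed class `[U]`, so cutting `A i` down to `U` keeps
    -- it dense there.
    calc mk U = ClosureAlgebra.cl (mk (A i)) ⊓ mk U := (inf_eq_right.2 (hA i)).symm
      _ = ClosureAlgebra.cl (mk (A i) ⊓ mk U) := (cl_inf_of_isClosedElem _ hUc).symm
      _ = ClosureAlgebra.cl (mk (U ∩ A i)) := by rw [inf_comm]; rfl
      _ ≤ ClosureAlgebra.cl (mk (E i)) :=
        ModalFormula.cl_mono ((hmkC i).trans (isMeagre_diff_of_subset (hCE i)))
  have hCdisj : ∀ i j x, x ∈ C i → x ∈ C j → i = j := by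
    intro i j x hi hj
    by_contra hij
    rcases lt_or_gt_of_ne hij with h | h
    · exact hj.2 (Set.mem_iUnion₂.2 ⟨i, h, hi.1.2⟩)
    · exact hi.2 (Set.mem_iUnion₂.2 ⟨j, h, hj.1.2⟩)
  have hEdisj : ∀ i j x, x ∈ E i → x ∈ E j → i = j := by
    intro i j x hi hj
    rcases hEC i x hi with hiC | ⟨hi0, hiC⟩ <;> rcases hEC j x hj with hjC | ⟨hj0, hjC⟩
    · exact hCdisj i j x hiC hjC
    · exact absurd (Set.mem_iUnion.2 ⟨i, hiC⟩) hjC.2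
    · exact absurd (Set.mem_iUnion.2 ⟨j, hjC⟩) hiC.2
    · exact hi0.trans hj0.symm
  have hcover : ∀ x ∈ U, ∃ i, x ∈ E i := by
    intro x hx
    by_cases h : x ∈ ⋃ j, C j
    · obtain ⟨j, hj⟩ := Set.mem_iUnion.1 h
      exact ⟨j, hCE j hj⟩
    · exact ⟨0, by simp only [E, if_true]; exact Or.inr ⟨hx, h⟩⟩
  have hne' : ∀ i, (E i).Nonempty := by
    intro i
    rw [Set.nonempty_iff_ne_empty]
    intro h
    -- An empty part would have closure `⊥`, whereas `[U] ≠ ⊥` in a Baire space.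
    have h' := hclE i
    rw [h] at h'
    exact hUbot (h'.symm.trans ClosureAlgebra.cl_bot)
  obtain ⟨e⟩ : Nonempty (κ.out ≃ Fin (n + 1)) := by
    have : Cardinal.lift.{0} (Cardinal.mk κ.out) = Cardinal.lift (Cardinal.mk (Fin (n + 1))) := by
      simp [hκ]
    exact Cardinal.lift_mk_eq'.1 this
  refine ⟨fun i => E (e i), fun i => hne' _, fun i j hij => Set.disjoint_left.2 fun x hi hj =>
    hij (e.injective (hEdisj _ _ x hi hj)), ?_, fun i => hclE _⟩
  refine Set.Subset.antisymm (Set.iUnion_subset fun i => hEU _) fun x hx => ?_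
  obtain ⟨i, hi⟩ := hcover x hx
  exact Set.mem_iUnion.2 ⟨e.symm i, by simpa using hi⟩

/-- Where the axiom fails, the premise puts every `φ i` densely on an open set, and the failed
conclusion makes their pairwise meets meagre there: a forbidden resolution. -/
theorem val_axAlt [BaireSpace X] {κ : Cardinal} {n : ℕ} (hκ : κ = ((n + 1 : ℕ) : Cardinal))
    (hX : NowhereBaireResolvable X κ) {P : Type*} (V : P → BaireAlgebra X)
    (φ : Fin (n + 1) → ModalFormula P) :
    ModalFormula.val V (ModalFormula.axAlt n φ) = ⊤ := by
  rw [ModalFormula.axAlt, ModalFormula.val_imp_eq_top_iff, ← disjoint_compl_right_iff,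
    disjoint_iff]
  by_contra hne
  set c := ModalFormula.listConj (ModalFormula.dia (φ 0))
    (List.ofFn fun i : Fin n => ModalFormula.dia (φ i.succ)) with hc
  set l := (((List.finRange (n + 1) ×ˢ List.finRange (n + 1)).filter fun q => q.1 < q.2).map
        fun q => ModalFormula.dia (ModalFormula.conj (φ q.1) (φ q.2))) with hl
  have hcc : IsClosedElem (ModalFormula.val V c) := by
    refine isClosedElem_val_listConj V _ _ (isClosedElem_cl _) fun ψ hψ => ?_
    obtain ⟨i, rfl⟩ := List.mem_ofFn.1 hψ
    exact isClosedElem_cl _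
  have hdc : IsClosedElem (ModalFormula.val V
      (ModalFormula.listDisj (ModalFormula.contra (φ 0)) l)) := by
    refine isClosedElem_val_listDisj V _ _ ?_ fun ψ hψ => ?_
    · rw [ModalFormula.val_contra]
      exact isClosedElem_bot
    · obtain ⟨q, -, rfl⟩ := List.mem_map.1 hψ
      exact isClosedElem_cl _
  obtain ⟨U, hU, hUeq⟩ := (hcc.inf hdc.compl).exists_isOpen
  rw [hUeq] at hne
  have hUne : U.Nonempty := by
    rw [Set.nonempty_iff_ne_empty]
    rintro rfl
    exact hne rfl
  have hrep : ∀ i, ∃ A, ModalFormula.val V (φ i) = mk A := fun i =>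
    ind (p := fun a => ∃ A, a = mk A) (fun A => ⟨A, rfl⟩) _
  choose A hA using hrep
  refine hX ⟨U, hU, hUne, isBaireResolvable_of_fin hU hUne A (fun i => ?_) (fun i j hij => ?_) hκ⟩
  · rw [← hUeq, ← hA]
    refine inf_le_left.trans ?_
    have h := ModalFormula.val_listConj V (ModalFormula.dia (φ 0))
      (List.ofFn fun i : Fin n => ModalFormula.dia (φ i.succ))
    refine Fin.cases h.1 (fun i => ?_) i
    exact h.2 (ModalFormula.dia (φ i.succ)) (List.mem_ofFn.2 ⟨i, rfl⟩)
  · have h := ModalFormula.val_le_val_listDisj V (ModalFormula.contra (φ 0)) l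
      (ModalFormula.dia (ModalFormula.conj (φ i) (φ j))) (by
        simp only [hl, List.mem_map, List.mem_filter, decide_eq_true_eq]
        exact ⟨(i, j), ⟨by simp, hij⟩, rfl⟩)
    have h' : mk (A i ∩ A j) ≤ ModalFormula.val V
        (ModalFormula.listDisj (ModalFormula.contra (φ 0)) l) := by
      refine le_trans ?_ h
      refine le_trans ?_ (ClosureAlgebra.le_cl _)
      simp only [ModalFormula.val, hA]
      exact le_rfl
    rw [← hUeq]
    exact Disjoint.mono inf_le_right h' disjoint_compl_left

/-! ### Completeness from resolutions -/

/-- A universal model indexed by the parts of a resolution of the space is refuted by a valuation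
in the Baire algebra. -/
theorem exists_val_eq_top_iff [BaireSpace X] {ι P : Type*} {A : ι → Set X}
    (hne : ∀ i, (A i).Nonempty)
    (hdisj : Pairwise fun i j => Disjoint (A i) (A j)) (hcover : ⋃ i, A i = Set.univ)
    (hcl : ∀ i, ClosureAlgebra.cl (mk (A i)) = mk Set.univ)
    {F : ι → ModalFormula P → Prop} (hF : ModalFormula.IsUniversalModel F) :
    ∃ V : P → BaireAlgebra X, ∀ ψ, ModalFormula.val V ψ = ⊤ ↔ ∀ i, F i ψ := by
  have hidx : ∀ x, ∃ i, x ∈ A i := fun x => Set.mem_iUnion.1 (hcover ▸ Set.mem_univ x)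
  choose idx hidx using hidx
  have hidx' : ∀ i, ∀ x ∈ A i, idx x = i := fun i x hx => by
    by_contra h
    exact Set.disjoint_left.1 (hdisj h) (hidx x) hx
  have hval : ∀ ψ, ModalFormula.val (fun p => mk {x | F (idx x) (.var p)}) ψ
      = mk {x | F (idx x) ψ} := by
    intro ψ
    induction ψ with
    | var p => rfl
    | conj φ ψ ih₁ ih₂ =>
      simp only [ModalFormula.val, ih₁, ih₂, (hF.isAssignment _).conj_iff]
      rfl
    | neg φ ih =>
      simp only [ModalFormula.val, ih, (hF.isAssignment _).neg_iff]
      rfl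
    | dia φ ih =>
      simp only [ModalFormula.val, ih, hF.dia_iff]
      -- The truth of `◇φ` does not depend on the world. If `φ` holds at `j`, its truth set contains
      -- `A j`, whose closure is already `⊤`; otherwise that set is empty.
      by_cases h : ∃ j, F j φ
      · simp only [h, Set.ofPred_true]
        obtain ⟨j, hj⟩ := h
        refine le_antisymm le_top ?_
        rw [← hcl j]
        refine ModalFormula.cl_mono (isMeagre_diff_of_subset fun x hx => ?_)
        simpa only [Set.mem_ofPred_eq, hidx' j x hx] using hj
      · have h' : ∀ j, ¬ F j φ := not_exists.1 h
        simp only [h', Set.ofPred_false, exists_false]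
        exact ClosureAlgebra.cl_bot
  refine ⟨fun p => mk {x | F (idx x) (.var p)}, fun ψ => ?_⟩
  rw [hval]
  constructor
  · intro h i
    by_contra hi
    -- The truth set of `ψ` is comeagre but misses `A i`, so `A i` would be meagre, against `cl (mk
    -- (A i)) = ⊤` in a nonempty Baire space.
    have hbot : mk (A i) = ⊥ := by
      rw [← compl_eq_top, ← top_le_iff, ← h]
      refine isMeagre_diff_of_subset fun x hx hxA => hi ?_
      rw [← hidx' i x hxA]
      exact hx
    obtain ⟨x, -⟩ := hne i
    refine mk_ne_bot_of_isOpen (X := X) isOpen_univ ⟨x, trivial⟩ ?_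
    rw [← hcl i, hbot, ClosureAlgebra.cl_bot]
  · intro h
    simp only [h, Set.ofPred_true]
    rfl

/-- Completeness for the Baire algebra of a resolvable space of a logic whose consistent sets have
universal models indexed by a set that is not larger than the number of parts. -/
theorem stronglyCompleteFor [BaireSpace X] {κ : Cardinal}
    (hres : IsBaireResolvable (Set.univ : Set X) κ) {ι P : Type*}
    {g : κ.out → ι} (hg : Function.Surjective g) {L : Set (ModalFormula P)}
    (hL : ∀ Γ φ, ¬ DerivableFrom L Γ φ → ∃ F : ι → ModalFormula P → Prop,
      ModalFormula.IsUniversalModel F ∧ (∀ i, ∀ ψ ∈ {ψ | DerivableFrom L Γ ψ}, F i ψ) ∧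
        ∃ i, ¬ F i φ) : StronglyCompleteFor L (BaireAlgebra X) := by
  intro Γ φ h
  by_contra hφ
  obtain ⟨F, hF, hΓ, i, hi⟩ := hL Γ φ hφ
  obtain ⟨j, rfl⟩ := hg i
  obtain ⟨A, hne, hdisj, hcover, hcl⟩ := hres
  obtain ⟨V, hV⟩ := exists_val_eq_top_iff hne hdisj hcover hcl (hF.comp hg)
  exact hi ((hV φ).1 (h V fun γ hγ => (hV γ).2 fun k => hΓ _ γ (.hyp hγ)) j)

end BaireAlgebra

/-! ### The main theorem -/

theorem mainTheorem3 {X : Type u} [TopologicalSpace X] [BaireSpace X]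
    (κ : Cardinal.{v}) (hκ : κ ≠ 0) (hres : IsBaireResolvable (Set.univ : Set X) κ) :
    (Cardinal.aleph0 ≤ κ → ∀ P : Type v, Cardinal.mk P = κ →
      SoundFor (logicS5 P) (BaireAlgebra X) ∧
        StronglyCompleteFor (logicS5 P) (BaireAlgebra X)) ∧
    (∀ n : ℕ, κ = n → NowhereBaireResolvable X (κ + 1) →
      SoundFor (logicS5n ℕ n) (BaireAlgebra X) ∧
        StronglyCompleteFor (logicS5n ℕ n) (BaireAlgebra X)) := by
  refine ⟨fun hinf P hP => ⟨fun φ hφ => S4Extension.val_eq_top ?_ hφ, ?_⟩,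
    fun n hn hX => ⟨fun φ hφ => S4Extension.val_eq_top ?_ hφ, ?_⟩⟩
  · rintro _ ⟨ψ, rfl⟩ V
    exact BaireAlgebra.val_axFive V ψ
  · have : Infinite P := Cardinal.infinite_iff.2 (hP ▸ hinf)
    have : Nonempty (ModalFormula P) := (inferInstance : Nonempty P).map .var
    have hle : Cardinal.mk (ModalFormula P) ≤ Cardinal.mk κ.out := by
      rw [Cardinal.mk_out, ← hP]
      exact ModalFormula.mk_le_mk_of_infinite P
    -- There are at least as many parts as formulas, and formulas index the worlds; a left inverse
    -- of `e` maps parts onto worlds.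
    obtain ⟨e⟩ := (Cardinal.le_def _ _).1 hle
    exact BaireAlgebra.stronglyCompleteFor hres (Function.invFun_surjective e.injective)
      fun Γ φ hφ => (ModalFormula.isS5Theory_derivableFrom subset_rfl Γ).exists_isUniversalModel hφ
  · rintro _ (⟨ψ, rfl⟩ | ⟨ψ, rfl⟩) V
    · exact BaireAlgebra.val_axFive V ψ
    · exact BaireAlgebra.val_axAlt (by rw [hn]; push_cast; rfl) hX V ψ
  · obtain ⟨e⟩ : Nonempty (κ.out ≃ Fin n) := by
      have : Cardinal.lift.{0} (Cardinal.mk κ.out) = Cardinal.lift (Cardinal.mk (Fin n)) := by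
        simp [hn]
      exact Cardinal.lift_mk_eq'.1 this
    exact BaireAlgebra.stronglyCompleteFor hres e.surjective fun Γ φ hφ =>
      (ModalFormula.isS5Theory_derivableFrom
          (Ax := Set.range ModalFormula.axFive ∪ Set.range (ModalFormula.axAlt n))
          Set.subset_union_left Γ).exists_isUniversalModel_fin
        (fun ψ => .thm (.extra (Or.inr (Set.mem_range_self ψ)))) hφ
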